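/- Let $\mathcal{M}=(G=(S,E),S_1,S_2,\delta)$ be a finite Markov decision process: $G$ is a finite directed graph in which every state has a successor, $S_1,S_2$ partition $S$ into the states of player 1 and the stochastic states, and for every $s\in S_2$, $\delta(s)$ is a rational probability distribution on $S$ whose support is the set of successors of $s$. A strategy $\lambda$ of player 1 maps every finite path ending in a state of $S_1$ to a rational probability distribution supported on successors of that state; $\mathrm{Out}_s(\lambda)$ is the set of infinite paths from $s$ consistent with $\lambda$, and $\mathbb{P}^{\lambda}_{\mathcal{M},s}$ is the probability measure induced by $\lambda$ on infinite paths from $s$. For $p\colon S\to\mathbb{N}$, the parity objective $p$ is the set of infinite paths $\pi$ for which the maximum of $p$ over the states visited infinitely often by $\pi$ is even. Let $p_1,p_2\colon S\to\mathbb{N}$ be two priority functions. An end-component of $\mathcal{M}$ is a set $C\subseteq S$ such that all successors of states of $C\cap S_2$ are in $C$, every state of $C\cap S_1$ has a successor in $C$, and any two states of $C$ are joined by a path that stays in $C$; $\mathcal{M}_{\downharpoonright C}$ denotes the Markov decision process obtained by restricting $\mathcal{M}$ to $C$. An end-component $C$ is very-good if - for every $s\in C$ there is a strategy $\lambda$ in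 $\mathcal{M}$ with $\mathrm{Out}_s(\lambda)\subseteq p_1$, and - for every $s\in C$ there is a strategy $\lambda$ in $\mathcal{M}_{\downharpoonright C}$ with $\mathbb{P}^{\lambda}_{\mathcal{M}_{\downharpoonright C},s}[p_1]=1$ and $\mathbb{P}^{\lambda}_{\mathcal{M}_{\downharpoonright C},s}[p_2]=1$. Then for every very-good end-component $C$, every $s\in C$ and every real $\varepsilon\in(0,1]$, there is a strategy $\lambda$ of player 1 in $\mathcal{M}$ such that $\mathrm{Out}_s(\lambda)\subseteq p_1$ and $\mathbb{P}^{\lambda}_{\mathcal{M},s}[p_2]>1-\varepsilon$. -/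

import Mathlib

open MeasureTheory ProbabilityTheory
open scoped NNReal ENNReal

/-- A rational probability distribution on a finite set. -/
structure RatDist (A : Type*) [Fintype A] where
  /-- the probability of each element, a nonnegative rational -/
  prob : A → ℚ≥0
  sum_eq_one : ∑ a, prob a = 1

namespace RatDist

variable {A : Type*} [Fintype A]

/-- The support of a distribution. -/
def supp (p : RatDist A) : Set A := {a | 0 < p.prob a}

/-- The distribution as one of Mathlib's probability mass functions. -/
noncomputable def toPMF (p : RatDist A) : PMF A :=
  PMF.ofFintype (fun a => ((p.prob a : ℝ≥0) : ℝ≥0∞)) (by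
    rw [← ENNReal.ofNNReal_finsetSum, ← NNRat.cast_sum, p.sum_eq_one]
    simp)

end RatDist

/-- A finite Markov decision process on the state set `S`: a non-blocking directed graph, the set
`S₁` of the states of player 1 (the states of the stochastic player 2 form its complement), and
for every stochastic state a distribution whose support is the set of its successors. -/
structure MDP (S : Type*) [Fintype S] where
  /-- the edge relation -/
  E : S → S → Prop
  exists_succ : ∀ s, ∃ t, E s t
  /-- the states of player 1 -/
  S₁ : Set S
  /-- the transition function on the stochastic states -/
  δ : ∀ s, s ∉ S₁ → RatDist S
  supp_δ : ∀ s (hs : s ∉ S₁), (δ s hs).supp = {t | E s t}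

namespace MDP

variable {S : Type*} [Fintype S]

/-- The finite sequences `s₀ s₁ ⋯ sₙ` of states. -/
abbrev Hist (S : Type*) (n : ℕ) : Type _ := Finset.Iic n → S

/-- The last state `sₙ` of a finite sequence `s₀ ⋯ sₙ`. -/
def Hist.last {n : ℕ} (ρ : Hist S n) : S := ρ ⟨n, Finset.mem_Iic.2 le_rfl⟩

/-- The initial segment `π(0) ⋯ π(n)` of an infinite sequence. -/
def initSeg (π : ℕ → S) (n : ℕ) : Hist S n := fun i => π i

variable (M : MDP S)

/-- `π` is a play: an infinite path in the graph. -/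
def IsPlay (π : ℕ → S) : Prop := ∀ n, M.E (π n) (π (n + 1))

/-- `ρ` is a prefix: a finite nonempty path in the graph. (As the graph is non-blocking, these are
exactly the initial segments of plays.) -/
def IsPref {n : ℕ} (ρ : Hist S n) : Prop :=
  ∀ (i : ℕ) (hi : i < n),
    M.E (ρ ⟨i, Finset.mem_Iic.2 hi.le⟩) (ρ ⟨i + 1, Finset.mem_Iic.2 hi⟩)

/-- A strategy of player 1: it assigns to every prefix that ends in a state of player 1 a
distribution supported on the successors of this state. The values of `act` at all other
sequences are irrelevant. -/
structure Strategy where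
  /-- the distribution of the next state after a given history -/
  act : ∀ n : ℕ, Hist S n → RatDist S
  supp_subset : ∀ (n : ℕ) (ρ : Hist S n), M.IsPref ρ → ρ.last ∈ M.S₁ →
    (act n ρ).supp ⊆ {t | M.E ρ.last t}

variable {M} in
/-- `π` is consistent with the strategy `σ`. -/
def Strategy.Consistent (σ : M.Strategy) (π : ℕ → S) : Prop :=
  ∀ n, π n ∈ M.S₁ → π (n + 1) ∈ (σ.act n (initSeg π n)).supp

variable {M} in
/-- The plays from `s` that are consistent with `σ`. -/
def Strategy.Out (σ : M.Strategy) (s : S) : Set (ℕ → S) :=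
  {π | M.IsPlay π ∧ π 0 = s ∧ σ.Consistent π}

open Classical in
variable {M} in
/-- The distribution of the next state after the history `ρ`, when player 1 follows `σ`. -/
noncomputable def Strategy.nextDist (σ : M.Strategy) (n : ℕ) (ρ : Hist S n) : RatDist S :=
  if h : ρ.last ∈ M.S₁ then σ.act n ρ else M.δ ρ.last h

section Probability

variable [MeasurableSpace S] [DiscreteMeasurableSpace S]

variable {M} in
/-- The transition kernel from histories of length `n + 1` to the next state. -/
noncomputable def Strategy.kernel (σ : M.Strategy) (n : ℕ) : Kernel (Hist S n) S :=
  Kernel.ofFunOfCountable fun ρ => (σ.nextDist n ρ).toPMF.toMeasure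

instance (σ : M.Strategy) (n : ℕ) : IsMarkovKernel (σ.kernel n) :=
  ⟨fun ρ => inferInstanceAs (IsProbabilityMeasure (σ.nextDist n ρ).toPMF.toMeasure)⟩

variable {M} in
/-- The probability measure on infinite sequences of states (with the product σ-algebra) obtained
by running the process from `s` under `σ`: the Ionescu-Tulcea measure of the transition kernels. -/
noncomputable def Strategy.prob (σ : M.Strategy) (s : S) : Measure (ℕ → S) :=
  Kernel.traj (X := fun _ => S) σ.kernel 0 (fun _ => s)

instance (σ : M.Strategy) (s : S) : IsProbabilityMeasure (σ.prob s) :=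
  inferInstanceAs
    (IsProbabilityMeasure (Kernel.traj (X := fun _ => S) σ.kernel 0 (fun _ => s)))

end Probability

/-- The states visited infinitely often. -/
def infStates (π : ℕ → S) : Set S := {s | ∀ i, ∃ j, i ≤ j ∧ π j = s}

/-- The parity objective: the plays for which the maximal priority seen infinitely often is
even. -/
def parity (p : S → ℕ) : Set (ℕ → S) :=
  {π | M.IsPlay π ∧ ∃ m, IsGreatest (p '' infStates π) m ∧ Even m}

variable {M} in
/-- `s, σ ⊨ S(A)`: every play from `s` consistent with `σ` belongs to `A`. -/
def Strategy.Sure (σ : M.Strategy) (s : S) (A : Set (ℕ → S)) : Prop := σ.Out s ⊆ A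

/-- A trap for player 2: a set of states that player 2 cannot leave and in which player 1 can
always stay. -/
def IsTrap₂ (C : Finset S) : Prop :=
  (∀ s ∈ C, s ∉ M.S₁ → ∀ t, M.E s t → t ∈ C) ∧
  (∀ s ∈ C, s ∈ M.S₁ → ∃ t ∈ C, M.E s t)

/-- An end-component: a trap for player 2 which is strongly connected (any two of its states are
joined by a path that stays in it). -/
structure IsEC (C : Finset S) : Prop where
  trap : M.IsTrap₂ C
  connected : ∀ s t : C, Relation.ReflTransGen (fun a b : C => M.E a b) s t

/-- The sub-MDP induced by an end-component. -/
def sub (C : Finset S) (hC : M.IsEC C) : MDP C where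
  E s t := M.E s t
  exists_succ s := by
    by_cases h : (s : S) ∈ M.S₁
    · obtain ⟨t, ht, hst⟩ := hC.trap.2 s s.2 h
      exact ⟨⟨t, ht⟩, hst⟩
    · obtain ⟨t, hst⟩ := M.exists_succ s
      exact ⟨⟨t, hC.trap.1 s s.2 h t hst⟩, hst⟩
  S₁ := {s | (s : S) ∈ M.S₁}
  δ s hs :=
    { prob := fun t => (M.δ s hs).prob t
      sum_eq_one := by
        rw [Finset.sum_coe_sort C (M.δ s hs).prob, ← (M.δ s hs).sum_eq_one]
        refine Finset.sum_subset (Finset.subset_univ C) fun t _ ht => ?_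
        by_contra h0
        have h1 : t ∈ (M.δ s hs).supp := pos_iff_ne_zero.2 h0
        rw [M.supp_δ s hs] at h1
        exact ht (hC.trap.1 s s.2 hs t h1) }
  supp_δ s hs := by
    ext t
    exact Set.ext_iff.1 (M.supp_δ s hs) (t : S)

/-- A very-good end-component for the priority functions `p₁`, `p₂`: from each of its states,
player 1 can surely satisfy `p₁` in the whole MDP, and he can, inside the component and with one
and the same strategy, satisfy both `p₁` and `p₂` almost surely. -/
structure IsVGEC [MeasurableSpace S] [DiscreteMeasurableSpace S] (p₁ p₂ : S → ℕ)
    (C : Finset S) : Prop where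
  isEC : M.IsEC C
  sure : ∀ s ∈ C, ∃ σ : M.Strategy, σ.Sure s (M.parity p₁)
  almostSure : ∀ s : C, ∃ σ : (M.sub C isEC).Strategy,
    σ.prob s ((M.sub C isEC).parity fun t => p₁ t) = 1 ∧
    σ.prob s ((M.sub C isEC).parity fun t => p₂ t) = 1

end MDP

/-!
Run in `C` a strategy that satisfies both objectives almost surely. With probability one the set of
infinitely visited states is closed under the moves of player 2, so some play that satisfies both
objectives has a limit set `D ⊆ C` which player 2 cannot leave, which player 1 can traverse
completely, and whose greatest priority is even for `p₁` as well as for `p₂`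
(`MDP.IsVGEC.exists_isClosedClass`).

Let `U` choose uniformly among the moves that leave neither `C` nor, once it is entered, `D`. From
`C` every state of `D` is reachable by such moves, so under `U` the limit set is almost surely `D`
(`MDP.Strategy.ae_of_nextDist_eq_memoryless`, `MDP.infStates_eq_of_stays`). In particular a state
`x ∈ D` of greatest priority for `p₁` is almost surely visited infinitely often, and time can be cut
into windows such that, with probability greater than `1 - ε`, `x` is visited in every window
(`MDP.exists_windows`).

The required strategy follows `U`, and at the end of the first window without a visit to `x` it
switches for good to a strategy that surely satisfies `p₁` from the current state. If the switch
occurs, `p₁` holds because parity objectives do not depend on finite prefixes. If it does not, `x`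
is visited infinitely often, hence `D` is entered and never left, and `p₁` holds again. As long as
there is no switch, the strategy coincides with `U`; so the switch has the same probability as the
corresponding event under `U`, less than `ε` (`MDP.Strategy.prob_switch_bad`), and without a switch
the limit set is almost surely `D`, so that `p₂` holds.

The probabilistic input is the conditional law of the next state
(`MDP.Strategy.condExp_apply_succ`), used through Lévy's conditional Borel–Cantelli lemma
(`MDP.Strategy.ae_mem_infStates`) and through the formula for the probability of a cylinder
(`MDP.Strategy.prob_initSeg_and_apply_succ`).
-/

/-! ### Rational distributions -/

namespace RatDist

variable {A : Type*} [Fintype A]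

theorem toPMF_apply_toReal (p : RatDist A) (a : A) : (p.toPMF a).toReal = (p.prob a : ℝ) := by
  have h : p.toPMF a = ((p.prob a : ℝ≥0) : ℝ≥0∞) := rfl
  rw [h, ENNReal.coe_toReal]
  exact map_nnratCast NNReal.toRealHom _

open Classical in
/-- The uniform distribution on a nonempty finite set. -/
noncomputable def uniform (F : Finset A) (hF : F.Nonempty) : RatDist A where
  prob a := if a ∈ F then (F.card : ℚ≥0)⁻¹ else 0
  sum_eq_one := by
    have h : (F.card : ℚ≥0) ≠ 0 := by simpa using hF.ne_empty
    rw [Finset.sum_ite_mem, Finset.univ_inter, Finset.sum_const, nsmul_eq_mul, mul_inv_cancel₀ h]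

theorem supp_uniform (F : Finset A) (hF : F.Nonempty) : (uniform F hF).supp = F := by
  ext a
  by_cases h : a ∈ F <;> simp [supp, uniform, h, hF]

end RatDist

namespace MDP

variable {S : Type*} [Fintype S] {M : MDP S}

/-! ### The measure induced by a strategy -/

section Probability

variable [MeasurableSpace S] [DiscreteMeasurableSpace S]

theorem measurableSet_apply_eq (n : ℕ) (b : S) : MeasurableSet {π : ℕ → S | π n = b} :=
  (measurable_pi_apply (X := fun _ : ℕ => S) n) (measurableSet_singleton b)

theorem measurableSet_piLE_initSeg (n : ℕ) (T : Set (Hist S n)) :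
    MeasurableSet[Filtration.piLE (X := fun _ : ℕ => S) n] {π : ℕ → S | initSeg π n ∈ T} := by
  rw [Filtration.piLE_eq_comap_frestrictLe]
  exact ⟨T, MeasurableSet.of_discrete, rfl⟩

theorem measurableSet_initSeg (n : ℕ) (T : Set (Hist S n)) :
    MeasurableSet {π : ℕ → S | initSeg π n ∈ T} :=
  Filtration.le _ n _ (measurableSet_piLE_initSeg n T)

theorem Strategy.prob_apply_zero (σ : M.Strategy) (s : S) : ∀ᵐ π ∂σ.prob s, π 0 = s := by
  have h : (σ.prob s).map (Preorder.frestrictLe 0) = Measure.dirac (fun _ => s) := by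
    rw [Strategy.prob, Kernel.traj_map_frestrictLe_apply, Kernel.partialTraj_self, Kernel.id_apply]
  have h2 : ∀ᵐ ρ ∂((σ.prob s).map (Preorder.frestrictLe (π := fun _ : ℕ => S) 0)),
      ρ ⟨0, by simp⟩ = s := by
    rw [h, ae_dirac_iff MeasurableSet.of_discrete]
  exact ae_of_ae_map (Preorder.measurable_frestrictLe 0).aemeasurable h2

/-- Given the first `n + 1` states, the next state has the distribution `nextDist`. -/
theorem Strategy.condExp_apply_succ (σ : M.Strategy) (s : S) (n : ℕ) (b : S) :
    (σ.prob s)[{π : ℕ → S | π (n + 1) = b}.indicator (1 : (ℕ → S) → ℝ) |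
        Filtration.piLE (X := fun _ : ℕ => S) n] =ᵐ[σ.prob s]
      fun π => ((σ.nextDist n (initSeg π n)).prob b : ℝ) := by
  have hint : Integrable ({π : ℕ → S | π (n + 1) = b}.indicator (1 : (ℕ → S) → ℝ)) (σ.prob s) :=
    (integrable_const 1).indicator (measurableSet_apply_eq _ _)
  filter_upwards [Kernel.condExp_traj (X := fun _ => S) (κ := σ.kernel) (Nat.zero_le n) hint]
    with π hπ
  refine Eq.trans hπ ?_
  rw [integral_indicator_one (measurableSet_apply_eq _ _)]
  have h := Kernel.map_traj_succ_self (X := fun _ => S) (κ := σ.kernel) (a := n)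
  have h2 : (Kernel.traj (X := fun _ => S) σ.kernel n (initSeg π n)) {π : ℕ → S | π (n + 1) = b}
      = (σ.nextDist n (initSeg π n)).toPMF b := by
    have h3 := congrArg (fun κ => κ (initSeg π n) {b}) h
    rw [Kernel.map_apply' _ (by fun_prop) _ (measurableSet_singleton b)] at h3
    refine Eq.trans h3 ?_
    exact PMF.toMeasure_apply_singleton _ _ (measurableSet_singleton b)
  rw [← RatDist.toPMF_apply_toReal, ← h2]
  rfl

/-- The probability of a cylinder, computed one step at a time. -/
theorem Strategy.prob_initSeg_and_apply_succ (σ : M.Strategy) (s : S) (n : ℕ) (ρ : Hist S n)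
    (b : S) :
    (σ.prob s).real {π | initSeg π n = ρ ∧ π (n + 1) = b} =
      (σ.prob s).real {π | initSeg π n = ρ} * ((σ.nextDist n ρ).prob b : ℝ) := by
  have hA := measurableSet_piLE_initSeg n {ρ}
  have hA' := measurableSet_initSeg n {ρ}
  have hint : Integrable ({π : ℕ → S | π (n + 1) = b}.indicator (1 : (ℕ → S) → ℝ)) (σ.prob s) :=
    (integrable_const 1).indicator (measurableSet_apply_eq _ _)
  have h1 := setIntegral_condExp (Filtration.le _ n) hint hA
  rw [setIntegral_indicator (measurableSet_apply_eq _ _)] at h1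
  have h2 : ∫ π in {π : ℕ → S | initSeg π n ∈ ({ρ} : Set (Hist S n))},
      ((σ.prob s)[{π : ℕ → S | π (n + 1) = b}.indicator (1 : (ℕ → S) → ℝ) |
        Filtration.piLE (X := fun _ : ℕ => S) n]) π ∂σ.prob s
      = ∫ π in {π : ℕ → S | initSeg π n ∈ ({ρ} : Set (Hist S n))},
        ((σ.nextDist n ρ).prob b : ℝ) ∂σ.prob s := by
    refine setIntegral_congr_ae hA' ?_
    filter_upwards [σ.condExp_apply_succ s n b] with π hπ hρ
    rw [hπ, Set.mem_singleton_iff.1 hρ]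
  rw [h2, setIntegral_const, smul_eq_mul] at h1
  simp only [Pi.one_apply, integral_const, MeasurableSet.univ, measureReal_restrict_apply,
    Set.univ_inter, smul_eq_mul, mul_one] at h1
  exact h1.symm

/-- Almost surely, every step of the play has positive probability. -/
theorem Strategy.ae_nextDist_pos (σ : M.Strategy) (s : S) :
    ∀ᵐ π ∂σ.prob s, ∀ n, 0 < (σ.nextDist n (initSeg π n)).prob (π (n + 1)) := by
  rw [ae_all_iff]
  intro n
  have h : ∀ (ρ : Hist S n) (b : S), (σ.nextDist n ρ).prob b = 0 →
      ∀ᵐ π ∂σ.prob s, ¬ (initSeg π n = ρ ∧ π (n + 1) = b) := by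
    intro ρ b h0
    have := σ.prob_initSeg_and_apply_succ s n ρ b
    rw [h0, NNRat.cast_zero, mul_zero, measureReal_eq_zero_iff] at this
    rw [ae_iff]
    simpa using this
  have h' : ∀ᵐ π ∂σ.prob s, ∀ (ρ : Hist S n) (b : S), (σ.nextDist n ρ).prob b = 0 →
      ¬ (initSeg π n = ρ ∧ π (n + 1) = b) := by
    simp only [ae_all_iff]
    exact h
  filter_upwards [h'] with π hπ
  exact pos_iff_ne_zero.2 fun h0 => hπ _ _ h0 ⟨rfl, rfl⟩

/-- By Lévy's conditional Borel–Cantelli lemma, a state that infinitely often has probability at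
least `c > 0` of being the next one is almost surely visited infinitely often. -/
theorem Strategy.ae_mem_infStates (σ : M.Strategy) (s b : S) {c : ℚ≥0} (hc : 0 < c) :
    ∀ᵐ π ∂σ.prob s, (∀ i, ∃ j, i ≤ j ∧ c ≤ (σ.nextDist j (initSeg π j)).prob b) →
      b ∈ infStates π := by
  have hlevy := ae_mem_limsup_atTop_iff (ℱ := Filtration.piLE (X := fun _ : ℕ => S)) (σ.prob s)
    (s := fun n => {π : ℕ → S | π n = b})
    (fun n => measurableSet_piLE_initSeg n {ρ | ρ.last = b})
  have hcond := ae_all_iff.2 fun n => σ.condExp_apply_succ s n b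
  filter_upwards [hlevy, hcond] with π h1 h2 h3
  have hmem : π ∈ Filter.limsup (fun n => {π : ℕ → S | π n = b}) Filter.atTop := by
    rw [h1]
    simp only [h2]
    rw [← not_summable_iff_tendsto_nat_atTop_of_nonneg (fun n => NNRat.cast_nonneg _)]
    intro hsum
    have hlim := hsum.tendsto_atTop_zero.eventually_lt_const
      (show (0 : ℝ) < c by exact_mod_cast hc)
    obtain ⟨i, hi⟩ := Filter.eventually_atTop.1 hlim
    obtain ⟨j, hij, hj⟩ := h3 i
    have h4 : ((c : ℝ)) ≤ ((σ.nextDist j (initSeg π j)).prob b : ℝ) := by exact_mod_cast hj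
    exact absurd (hi j hij) (not_lt.2 h4)
  rw [Filter.mem_limsup_iff_frequently_mem, Filter.frequently_atTop] at hmem
  exact hmem

/-- Two strategies that make the same choices along `π` up to time `n` give the same probability
to the cylinder of the initial segment of `π`. -/
theorem Strategy.prob_cylinder_eq (σ τ : M.Strategy) (s : S) (π : ℕ → S) (n : ℕ)
    (h : ∀ m < n, σ.nextDist m (initSeg π m) = τ.nextDist m (initSeg π m)) :
    (σ.prob s).real {ω | initSeg ω n = initSeg π n} =
      (τ.prob s).real {ω | initSeg ω n = initSeg π n} := by
  induction n with
  | zero =>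
    have key : ∀ υ : M.Strategy, (υ.prob s).real {ω | initSeg ω 0 = initSeg π 0} =
        (υ.prob s).real {_ω | s = π 0} := by
      intro υ
      refine measureReal_congr ?_
      filter_upwards [υ.prob_apply_zero s] with ω hω
      refine propext ⟨fun h0 => ?_, fun h0 => ?_⟩
      · exact hω.symm.trans (congrFun h0 ⟨0, by simp⟩)
      · funext ⟨i, hi⟩
        obtain rfl : i = 0 := by simpa using hi
        exact hω.trans h0
    rw [key, key]
    by_cases h0 : s = π 0 <;> simp [h0]
  | succ n ih =>
    have hset : {ω : ℕ → S | initSeg ω (n + 1) = initSeg π (n + 1)} =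
        {ω | initSeg ω n = initSeg π n ∧ ω (n + 1) = π (n + 1)} := by
      ext ω
      refine ⟨fun h0 => ⟨?_, congrFun h0 ⟨n + 1, by simp⟩⟩, fun h0 => ?_⟩
      · funext ⟨i, hi⟩
        exact congrFun h0 ⟨i, Finset.mem_Iic.2 ((Finset.mem_Iic.1 hi).trans n.le_succ)⟩
      · funext ⟨i, hi⟩
        rcases (Nat.le_succ_iff.1 (Finset.mem_Iic.1 hi)) with h1 | rfl
        · exact congrFun h0.1 ⟨i, Finset.mem_Iic.2 h1⟩
        · exact h0.2
    rw [hset, prob_initSeg_and_apply_succ, prob_initSeg_and_apply_succ,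
      ih fun m hm => h m (hm.trans n.lt_succ_self), h n n.lt_succ_self]

/-- Two strategies that make the same choices along the histories in `T` give the same probability
to `T`. -/
theorem Strategy.prob_initSeg_mem_eq (σ τ : M.Strategy) (s : S) (n : ℕ) (T : Set (Hist S n))
    (h : ∀ π : ℕ → S, initSeg π n ∈ T →
      ∀ m < n, σ.nextDist m (initSeg π m) = τ.nextDist m (initSeg π m)) :
    σ.prob s {π | initSeg π n ∈ T} = τ.prob s {π | initSeg π n ∈ T} := by
  have key : ∀ υ : M.Strategy, υ.prob s {π | initSeg π n ∈ T} =
      ∑ ρ ∈ T.toFinite.toFinset, υ.prob s {π | initSeg π n = ρ} := by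
    intro υ
    have := sum_measure_preimage_singleton (μ := υ.prob s) T.toFinite.toFinset
      (f := fun π : ℕ → S => initSeg π n) (fun ρ _ => measurableSet_initSeg n {ρ})
    refine Eq.trans ?_ this.symm
    congr 1
    ext π
    simp
  rw [key, key]
  refine Finset.sum_congr rfl fun ρ hρ => ?_
  have hρ' : ρ ∈ T := by simpa using hρ
  -- Every finite sequence is an initial segment: repeat its last state.
  obtain ⟨π, rfl⟩ : ∃ π : ℕ → S, initSeg π n = ρ := by
    refine ⟨fun i => ρ ⟨min i n, by simp⟩, ?_⟩
    funext ⟨i, hi⟩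
    have : min i n = i := min_eq_left (Finset.mem_Iic.1 hi)
    simp [initSeg, this]
  have := σ.prob_cylinder_eq τ s π n (h π hρ')
  exact (measureReal_eq_measureReal_iff).1 this

theorem measurableSet_parity (p : S → ℕ) : MeasurableSet (M.parity p) := by
  have hplay : MeasurableSet {π : ℕ → S | M.IsPlay π} := by
    have : {π : ℕ → S | M.IsPlay π} = ⋂ n, {π | M.E (π n) (π (n + 1))} := by
      ext π; simp [IsPlay]
    rw [this]
    refine MeasurableSet.iInter fun n => ?_
    have h : Measurable fun π : ℕ → S => (π n, π (n + 1)) := by fun_prop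
    exact h (MeasurableSet.of_discrete (s := {x : S × S | M.E x.1 x.2}))
  have hinf : ∀ a, MeasurableSet {π : ℕ → S | a ∈ infStates π} := by
    intro a
    have : {π : ℕ → S | a ∈ infStates π} = ⋂ i, ⋃ j, ⋃ (_ : i ≤ j), {π | π j = a} := by
      ext π; simp [infStates]
    rw [this]
    exact MeasurableSet.iInter fun i => MeasurableSet.iUnion fun j =>
      MeasurableSet.iUnion fun _ => measurableSet_apply_eq j a
  have hinf' : ∀ T : Set S, MeasurableSet {π : ℕ → S | infStates π = T} := by
    intro T
    have : {π : ℕ → S | infStates π = T} = ⋂ a, {π | a ∈ infStates π ↔ a ∈ T} := by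
      ext π; simp [Set.ext_iff]
    rw [this]
    exact MeasurableSet.iInter fun a => (hinf a).iff (MeasurableSet.const _)
  have : M.parity p = {π | M.IsPlay π} ∩
      ⋃ T : Set S, ⋃ (_ : ∃ m, IsGreatest (p '' T) m ∧ Even m), {π | infStates π = T} := by
    ext π
    simp [parity]
  rw [this]
  exact hplay.inter (MeasurableSet.iUnion fun T => MeasurableSet.iUnion fun _ => hinf' T)

end Probability

/-! ### Limit sets of plays -/

theorem infStates_shift {A : Type*} (π : ℕ → A) (m : ℕ) :
    infStates (fun i => π (m + i)) = infStates π := by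
  ext a
  refine ⟨fun h i => ?_, fun h i => ?_⟩
  · obtain ⟨j, hj, hπ⟩ := h i
    exact ⟨m + j, by omega, hπ⟩
  · obtain ⟨j, hj, hπ⟩ := h (m + i)
    exact ⟨j - m, by omega, (congrArg π (by omega)).trans hπ⟩

/-- As there are finitely many states, a sequence eventually visits only states that it visits
infinitely often. -/
theorem exists_forall_mem_infStates (π : ℕ → S) : ∃ N, ∀ n, N ≤ n → π n ∈ infStates π := by
  have h : ∀ a : S, ∃ N, a ∉ infStates π → ∀ n, N ≤ n → π n ≠ a := by
    intro a
    by_cases ha : a ∈ infStates π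
    · exact ⟨0, fun h => absurd ha h⟩
    · simp only [infStates, Set.mem_ofPred_eq, not_forall, not_exists, not_and] at ha
      obtain ⟨N, hN⟩ := ha
      exact ⟨N, fun _ => hN⟩
  choose N hN using h
  refine ⟨Finset.univ.sup N, fun n hn => ?_⟩
  by_contra hmem
  exact hN _ hmem n ((Finset.le_sup (Finset.mem_univ _)).trans hn) rfl

theorem infStates_nonempty (π : ℕ → S) : (infStates π).Nonempty :=
  let ⟨N, hN⟩ := exists_forall_mem_infStates π
  ⟨_, hN N le_rfl⟩

/-- A play can be followed inside the set of its infinitely visited states. -/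
theorem IsPlay.reflTransGen_infStates {π : ℕ → S} (hπ : M.IsPlay π) {a b : S}
    (ha : a ∈ infStates π) (hb : b ∈ infStates π) :
    Relation.ReflTransGen (fun x y => M.E x y ∧ y ∈ infStates π) a b := by
  obtain ⟨N, hN⟩ := exists_forall_mem_infStates π
  obtain ⟨i, hi, rfl⟩ := ha N
  obtain ⟨j, hj, rfl⟩ := hb i
  induction j, hj using Nat.le_induction with
  | base => exact .refl
  | succ j hij ih =>
    have hj' : π (j + 1) ∈ infStates π := hN _ (by omega)
    exact (ih (hN j (by omega))).tail ⟨hπ j, hj'⟩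

/-- Parity objectives do not depend on finite prefixes. -/
theorem mem_parity_of_shift {p : S → ℕ} {π : ℕ → S} (hπ : M.IsPlay π) (m : ℕ)
    (h : (fun i => π (m + i)) ∈ M.parity p) : π ∈ M.parity p := by
  refine ⟨hπ, ?_⟩
  have := h.2
  rwa [infStates_shift] at this

/-- A nonempty set of states that player 2 cannot leave, in which player 1 can always stay, and any
two of whose states are joined by a path inside it. These are the conditions of a nonempty
end-component, for a set of states of `M` that need not be presented as a `Finset`. -/
structure IsClosedClass (M : MDP S) (D : Set S) : Prop where
  nonempty : D.Nonempty
  closed : ∀ a ∈ D, a ∉ M.S₁ → ∀ b, M.E a b → b ∈ D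
  exists_succ : ∀ a ∈ D, ∃ b ∈ D, M.E a b
  connected : ∀ a ∈ D, ∀ b ∈ D, Relation.ReflTransGen (fun x y => M.E x y ∧ y ∈ D) a b

theorem IsPlay.isClosedClass_infStates {π : ℕ → S} (hπ : M.IsPlay π)
    (h : ∀ a b, a ∉ M.S₁ → M.E a b → a ∈ infStates π → b ∈ infStates π) :
    M.IsClosedClass (infStates π) where
  nonempty := infStates_nonempty π
  closed a ha ha' b hb := h a b ha' hb ha
  exists_succ a ha := by
    obtain ⟨N, hN⟩ := exists_forall_mem_infStates π
    obtain ⟨i, hi, rfl⟩ := ha N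
    exact ⟨_, hN _ (by omega), hπ i⟩
  connected _ ha _ hb := hπ.reflTransGen_infStates ha hb

theorem Strategy.nextDist_of_mem (σ : M.Strategy) {n : ℕ} {ρ : Hist S n} (h : ρ.last ∈ M.S₁) :
    σ.nextDist n ρ = σ.act n ρ := dif_pos h

theorem Strategy.nextDist_of_notMem (σ : M.Strategy) {n : ℕ} {ρ : Hist S n} (h : ρ.last ∉ M.S₁) :
    σ.nextDist n ρ = M.δ ρ.last h := dif_neg h

section Probability

variable [MeasurableSpace S] [DiscreteMeasurableSpace S]

/-- Under every strategy, almost surely the set of infinitely visited states is closed under the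
moves of player 2. -/
theorem Strategy.ae_infStates_closed (σ : M.Strategy) (s : S) :
    ∀ᵐ π ∂σ.prob s, ∀ a b, a ∉ M.S₁ → M.E a b → a ∈ infStates π → b ∈ infStates π := by
  simp only [ae_all_iff]
  intro a b ha hab
  have hpos : 0 < (M.δ a ha).prob b := by
    have : b ∈ (M.δ a ha).supp := by rw [M.supp_δ]; exact hab
    exact this
  filter_upwards [σ.ae_mem_infStates s b hpos] with π hπ hinf
  refine hπ fun i => ?_
  obtain ⟨j, hij, rfl⟩ := hinf i
  exact ⟨j, hij, by rw [σ.nextDist_of_notMem (ρ := initSeg π j) ha]; exact le_rfl⟩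

/-- A very-good end-component contains a set that player 1 can traverse without leaving it, and
whose greatest priority is even for both priority functions. -/
theorem IsVGEC.exists_isClosedClass {p₁ p₂ : S → ℕ} {C : Finset S} (hC : M.IsVGEC p₁ p₂ C)
    {s : S} (hs : s ∈ C) :
    ∃ D ⊆ (C : Set S), M.IsClosedClass D ∧ (∃ m, IsGreatest (p₁ '' D) m ∧ Even m) ∧
      ∃ m, IsGreatest (p₂ '' D) m ∧ Even m := by
  obtain ⟨σ, h1, h2⟩ := hC.almostSure ⟨s, hs⟩
  rw [← mem_ae_iff_prob_eq_one (measurableSet_parity _)] at h1 h2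
  -- A single play with all the almost sure properties provides the set.
  obtain ⟨π, hπ1, hπ2, hcl⟩ := (Filter.Eventually.and h1 (Filter.Eventually.and h2
    (σ.ae_infStates_closed ⟨s, hs⟩))).exists
  have hD := hπ1.1.isClosedClass_infStates hcl
  refine ⟨(↑) '' infStates π, ?_, ⟨hD.nonempty.image _, ?_, ?_, ?_⟩, ?_, ?_⟩
  · rintro _ ⟨a, -, rfl⟩
    exact a.2
  · rintro _ ⟨a, ha, rfl⟩ ha' b hb
    exact ⟨⟨b, hC.isEC.trap.1 a a.2 ha' b hb⟩, hD.closed a ha ha' _ hb, rfl⟩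
  · rintro _ ⟨a, ha, rfl⟩
    obtain ⟨b, hb, hab⟩ := hD.exists_succ a ha
    exact ⟨b, ⟨b, hb, rfl⟩, hab⟩
  · rintro _ ⟨a, ha, rfl⟩ _ ⟨b, hb, rfl⟩
    exact (hD.connected a ha b hb).lift _ fun x y hxy => ⟨hxy.1, y, hxy.2, rfl⟩
  · rw [Set.image_image]
    exact hπ1.2
  · rw [Set.image_image]
    exact hπ2.2

end Probability

/-! ### Memoryless and switching strategies -/

open Classical in
/-- The memoryless strategy that chooses uniformly among the `R`-successors of the last state. -/
noncomputable def memoryless (M : MDP S) (R : S → S → Prop) (hR : ∀ a, ∃ b, R a b)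
    (hRE : ∀ a b, R a b → M.E a b) : M.Strategy where
  act _ ρ := RatDist.uniform {b | R ρ.last b} (by simpa [Finset.Nonempty] using hR ρ.last)
  supp_subset n ρ _ _ := by
    rw [RatDist.supp_uniform]
    intro b hb
    exact hRE _ _ (by simpa using hb)

theorem supp_memoryless {R : S → S → Prop} (hR : ∀ a, ∃ b, R a b)
    (hRE : ∀ a b, R a b → M.E a b) {n : ℕ} (ρ : Hist S n) :
    ((M.memoryless R hR hRE).act n ρ).supp = {b | R ρ.last b} := by
  rw [memoryless, RatDist.supp_uniform]
  simp

/-- The first `m + 1` states of a longer history. -/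
def Hist.take {n m : ℕ} (ρ : Hist S n) (h : m ≤ n) : Hist S m :=
  fun i => ρ ⟨i, Finset.mem_Iic.2 ((Finset.mem_Iic.1 i.2).trans h)⟩

/-- The part of a history from time `m` on. -/
def Hist.drop {n m : ℕ} (ρ : Hist S n) (h : m ≤ n) : Hist S (n - m) :=
  fun i => ρ ⟨m + i, Finset.mem_Iic.2 (by have := Finset.mem_Iic.1 i.2; omega)⟩

theorem Hist.last_drop {A : Type*} {n m : ℕ} (ρ : Hist A n) (h : m ≤ n) :
    (ρ.drop h).last = ρ.last := by
  simp only [last, drop]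
  congr 2
  omega

theorem IsPref.drop {n m : ℕ} {ρ : Hist S n} (hρ : M.IsPref ρ) (h : m ≤ n) :
    M.IsPref (ρ.drop h) := fun i hi => hρ (m + i) (by omega)

open Classical in
/-- The strategy that follows `σ` up to the first time `m` at which `Bad` holds of the history, and
from then on follows `τ a`, started afresh in the state `a` at time `m`. -/
noncomputable def Strategy.switch (σ : M.Strategy) (τ : S → M.Strategy)
    (Bad : ∀ m, Hist S m → Prop) : M.Strategy where
  act n ρ :=
    if h : ∃ m, ∃ hm : m ≤ n, Bad m (ρ.take hm) then
      (τ (ρ.take (Nat.find_spec h).fst).last).act (n - Nat.find h) (ρ.drop (Nat.find_spec h).fst)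
    else σ.act n ρ
  supp_subset n ρ hρ hlast := by
    split_ifs with h
    · have := (τ (ρ.take (Nat.find_spec h).fst).last).supp_subset _ _
        (hρ.drop (Nat.find_spec h).fst) (by rwa [Hist.last_drop])
      rwa [Hist.last_drop] at this
    · exact σ.supp_subset n ρ hρ hlast

variable {σ : M.Strategy} {τ : S → M.Strategy} {Bad : ∀ m, Hist S m → Prop}

theorem Strategy.switch_act_of_forall_not {π : ℕ → S} {n : ℕ}
    (h : ∀ m ≤ n, ¬ Bad m (initSeg π m)) :
    (σ.switch τ Bad).act n (initSeg π n) = σ.act n (initSeg π n) := by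
  refine dif_neg ?_
  rintro ⟨m, hm, hbad⟩
  exact h m hm hbad

/-- From the switch at time `m` on, the strategy started afresh is the one that is played. -/
theorem Strategy.switch_act_add {π : ℕ → S} {m : ℕ} (hm : Bad m (initSeg π m))
    (h : ∀ k < m, ¬ Bad k (initSeg π k)) (j : ℕ) :
    (σ.switch τ Bad).act (m + j) (initSeg π (m + j)) =
      (τ (π m)).act j (initSeg (fun i => π (m + i)) j) := by
  classical
  have hex : ∃ k, ∃ hk : k ≤ m + j, Bad k ((initSeg π (m + j)).take hk) := ⟨m, by omega, hm⟩
  have hfind : Nat.find hex = m := by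
    rw [Nat.find_eq_iff]
    exact ⟨⟨by omega, hm⟩, fun k hk => fun ⟨_, hbad⟩ => h k hk hbad⟩
  refine (dif_pos hex).trans ?_
  change (τ (π (Nat.find _))).act (m + j - Nat.find _)
    (initSeg (fun i => π (Nat.find _ + i)) (m + j - Nat.find _)) = _
  have hj : m + j - Nat.find hex = j := by omega
  rw [hj, hfind]

/-- A play consistent with a switching strategy either is consistent with `σ` forever, or is
consistent with `σ` until the switch and with the new strategy afterwards. -/
theorem Strategy.mem_out_switch {s : S} {π : ℕ → S} (hπ : π ∈ (σ.switch τ Bad).Out s) :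
    ((∀ m, ¬ Bad m (initSeg π m)) ∧ σ.Consistent π) ∨
      ∃ m, (∀ k < m, π k ∈ M.S₁ → π (k + 1) ∈ (σ.act k (initSeg π k)).supp) ∧
        (fun i => π (m + i)) ∈ (τ (π m)).Out (π m) := by
  classical
  by_cases hbad : ∃ m, Bad m (initSeg π m)
  · right
    have hmin : ∀ k < Nat.find hbad, ¬ Bad k (initSeg π k) := fun k hk => Nat.find_min hbad hk
    refine ⟨Nat.find hbad, fun k hk hk1 => ?_, fun n => hπ.1 _, rfl, fun n hn => ?_⟩
    · rw [← switch_act_of_forall_not (τ := τ) (Bad := Bad) fun m hm => hmin m (by omega)]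
      exact hπ.2.2 k hk1
    · have := hπ.2.2 _ hn
      rwa [switch_act_add (Nat.find_spec hbad) hmin] at this
  · left
    push Not at hbad
    refine ⟨hbad, fun n hn => ?_⟩
    rw [← switch_act_of_forall_not (τ := τ) (Bad := Bad) fun m _ => hbad m]
    exact hπ.2.2 n hn

theorem Strategy.switch_nextDist_of_forall_not {π : ℕ → S} {n : ℕ}
    (h : ∀ m ≤ n, ¬ Bad m (initSeg π m)) :
    (σ.switch τ Bad).nextDist n (initSeg π n) = σ.nextDist n (initSeg π n) := by
  rw [nextDist, nextDist, switch_act_of_forall_not h]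

/-! ### Moves that stay in an end-component and a closed class -/

/-- The moves that stay in `C` and in `D` once these are entered. As nothing is required outside
`C` and `D`, every state of `M` has such a move, so that a memoryless strategy can follow them. -/
def Stays (M : MDP S) (C D : Set S) (a b : S) : Prop :=
  M.E a b ∧ (a ∈ C → b ∈ C) ∧ (a ∈ D → b ∈ D)

section Stays

variable {C : Finset S} {D : Set S}

theorem exists_stays (hC : M.IsTrap₂ C) (hDC : D ⊆ C) (hD : M.IsClosedClass D) (a : S) :
    ∃ b, M.Stays C D a b := by
  by_cases ha : a ∈ D
  · obtain ⟨b, hb, hab⟩ := hD.exists_succ a ha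
    exact ⟨b, hab, fun _ => hDC hb, fun _ => hb⟩
  · by_cases haC : a ∈ C
    · by_cases ha1 : a ∈ M.S₁
      · obtain ⟨b, hb, hab⟩ := hC.2 a haC ha1
        exact ⟨b, hab, fun _ => hb, fun h => absurd h ha⟩
      · obtain ⟨b, hab⟩ := M.exists_succ a
        exact ⟨b, hab, fun _ => hC.1 a haC ha1 b hab, fun h => absurd h ha⟩
    · obtain ⟨b, hab⟩ := M.exists_succ a
      exact ⟨b, hab, fun h => absurd h haC, fun h => absurd h ha⟩

theorem stays_of_notMem (hC : M.IsTrap₂ C) (hD : M.IsClosedClass D) {a b : S} (ha : a ∉ M.S₁)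
    (hab : M.E a b) : M.Stays C D a b :=
  ⟨hab, fun h => hC.1 a h ha b hab, fun h => hD.closed a h ha b hab⟩

/-- Each state of `D` can be reached from each state of `C`: a path of `C` may be followed until it
enters `D`, and from there one continues inside `D`. -/
theorem reflTransGen_stays (hC : M.IsEC C) (hDC : D ⊆ C) (hD : M.IsClosedClass D) {a d : S}
    (ha : a ∈ C) (hd : d ∈ D) : Relation.ReflTransGen (M.Stays C D) a d := by
  have hDD : ∀ x ∈ D, Relation.ReflTransGen (M.Stays C D) x d := fun x hx =>
    Relation.ReflTransGen.mono (fun _ _ h => ⟨h.1, fun _ => hDC h.2, fun _ => h.2⟩) _ _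
      (hD.connected x hx d hd)
  have key := hC.connected ⟨a, ha⟩ ⟨d, hDC hd⟩
  suffices h : ∀ x y : C, Relation.ReflTransGen (fun a b : C => M.E a b) x y → (y : S) = d →
      Relation.ReflTransGen (M.Stays C D) x d from h _ _ key rfl
  intro x y hxy hy
  induction hxy using Relation.ReflTransGen.head_induction_on with
  | refl => rw [hy]
  | @head x z h _ ih =>
    by_cases hx : (x : S) ∈ D
    · exact hDD _ hx
    · exact .head ⟨h, fun _ => z.2, fun h' => absurd h' hx⟩ ih

theorem mem_of_forall_stays {C : Set S} {π : ℕ → S} {m : ℕ}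
    (hπ : ∀ n < m, M.Stays C D (π n) (π (n + 1))) (h0 : π 0 ∈ C) : π m ∈ C := by
  induction m with
  | zero => exact h0
  | succ m ih => exact (hπ m (by omega)).2.1 (ih fun n hn => hπ n (by omega))

theorem infStates_subset_of_stays {C : Set S} {π : ℕ → S}
    (hπ : ∀ n, M.Stays C D (π n) (π (n + 1))) {d : S} (hd : d ∈ D) (hinf : d ∈ infStates π) :
    infStates π ⊆ D := by
  obtain ⟨i, -, rfl⟩ := hinf 0
  intro a ha
  obtain ⟨j, hj, rfl⟩ := ha i
  have h : ∀ k, π (i + k) ∈ D := fun k => by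
    induction k with
    | zero => exact hd
    | succ k ih => exact (hπ _).2.2 ih
  rw [← Nat.add_sub_of_le hj]
  exact h _

/-- A play that starts in `C`, follows the moves that stay in `C` and `D`, and whose limit set is
closed under these moves, has limit set `D`. -/
theorem infStates_eq_of_stays (hC : M.IsEC C) (hDC : D ⊆ C) (hD : M.IsClosedClass D) {π : ℕ → S}
    (h0 : π 0 ∈ C) (hπ : ∀ n, M.Stays C D (π n) (π (n + 1)))
    (hcl : ∀ a b, M.Stays C D a b → a ∈ infStates π → b ∈ infStates π) : infStates π = D := by
  have hsub : D ⊆ infStates π := by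
    intro d hd
    obtain ⟨a, ha⟩ := infStates_nonempty π
    have haC : a ∈ C := by
      obtain ⟨j, -, rfl⟩ := ha 0
      exact mem_of_forall_stays (π := π) (C := (C : Set S)) (fun n _ => hπ n) h0
    refine Relation.ReflTransGen.rec (motive := fun b _ => b ∈ infStates π) ha
      (fun _ h ih => hcl _ _ h ih) (reflTransGen_stays hC hDC hD haC hd)
  obtain ⟨d, hd⟩ := hD.nonempty
  exact (infStates_subset_of_stays hπ hd (hsub hd)).antisymm hsub

end Stays

/-! ### Probabilities under memoryless and switching strategies -/

section Probability

variable [MeasurableSpace S] [DiscreteMeasurableSpace S]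

/-- Switching does not affect the probability that the switch takes place. -/
theorem Strategy.prob_switch_bad (σ : M.Strategy) (τ : S → M.Strategy)
    (Bad : ∀ m, Hist S m → Prop) (s : S) :
    (σ.switch τ Bad).prob s {π | ∃ m, Bad m (initSeg π m)} =
      σ.prob s {π | ∃ m, Bad m (initSeg π m)} := by
  -- The event is the increasing union of the events that the switch takes place up to time `n`,
  -- whose complements consist of histories along which both strategies make the same choices.
  set T : ∀ n, Set (Hist S n) := fun n => {ρ | ∃ m, ∃ hm : m ≤ n, Bad m (ρ.take hm)} with hT
  have hU : {π : ℕ → S | ∃ m, Bad m (initSeg π m)} = ⋃ n, {π | initSeg π n ∈ T n} := by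
    ext π
    simp only [Set.mem_iUnion]
    exact ⟨fun ⟨m, hm⟩ => ⟨m, m, le_rfl, hm⟩, fun ⟨_, m, _, hm⟩ => ⟨m, hm⟩⟩
  have hmono : Monotone fun n => {π : ℕ → S | initSeg π n ∈ T n} := by
    rintro n n' hn π ⟨m, hm, hbad⟩
    exact ⟨m, hm.trans hn, hbad⟩
  rw [hU, hmono.measure_iUnion, hmono.measure_iUnion]
  refine iSup_congr fun n => ?_
  have h := (σ.switch τ Bad).prob_initSeg_mem_eq σ s n (T n)ᶜ fun π hπ m hm =>
    switch_nextDist_of_forall_not fun k hk hbad => hπ ⟨k, by omega, hbad⟩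
  have hc : {π : ℕ → S | initSeg π n ∈ (T n)ᶜ} = {π | initSeg π n ∈ T n}ᶜ := rfl
  rw [hc] at h
  rw [← compl_compl {π : ℕ → S | initSeg π n ∈ T n},
    prob_compl_eq_one_sub (measurableSet_initSeg n _).compl, h,
    ← prob_compl_eq_one_sub (measurableSet_initSeg n _).compl]

/-- Almost surely, a play along which `σ` chooses as the memoryless strategy for `R` follows `R`,
and its set of infinitely visited states is closed under `R`. -/
theorem Strategy.ae_of_nextDist_eq_memoryless (σ : M.Strategy) (s : S) {R : S → S → Prop}
    (hR : ∀ a, ∃ b, R a b) (hRE : ∀ a b, R a b → M.E a b)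
    (hER : ∀ a b, a ∉ M.S₁ → M.E a b → R a b) :
    ∀ᵐ π ∂σ.prob s,
      (∀ n, σ.nextDist n (initSeg π n) = (M.memoryless R hR hRE).nextDist n (initSeg π n)) →
      π 0 = s ∧ (∀ n, R (π n) (π (n + 1))) ∧
        ∀ a b, R a b → a ∈ infStates π → b ∈ infStates π := by
  set U := M.memoryless R hR hRE with hU
  have h1 : ∀ᵐ π ∂σ.prob s, ∀ a b, a ∈ M.S₁ → R a b →
      (∀ n, σ.nextDist n (initSeg π n) = U.nextDist n (initSeg π n)) →
      a ∈ infStates π → b ∈ infStates π := by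
    simp only [ae_all_iff]
    intro a b ha hab
    have hpos : 0 < (U.act 0 fun _ => a).prob b := by
      have : b ∈ (U.act 0 fun _ => a).supp := by rw [hU, supp_memoryless]; exact hab
      exact this
    filter_upwards [σ.ae_mem_infStates s b hpos] with π hπ heq hinf
    refine hπ fun i => ?_
    obtain ⟨j, hij, rfl⟩ := hinf i
    exact ⟨j, hij, by rw [heq, U.nextDist_of_mem (ρ := initSeg π j) ha]; exact le_rfl⟩
  filter_upwards [h1, σ.ae_infStates_closed s, σ.prob_apply_zero s, σ.ae_nextDist_pos s]
    with π h1 h2 h3 h4 heq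
  refine ⟨h3, fun n => ?_, fun a b hab ha => ?_⟩
  · have h5 : π (n + 1) ∈ (σ.nextDist n (initSeg π n)).supp := h4 n
    by_cases hn : (initSeg π n).last ∈ M.S₁
    · rw [heq, U.nextDist_of_mem hn, hU, supp_memoryless] at h5
      exact h5
    · rw [σ.nextDist_of_notMem hn, M.supp_δ] at h5
      exact hER _ _ hn h5
  · by_cases ha1 : a ∈ M.S₁
    · exact h1 a b ha1 hab heq ha
    · exact h2 a b ha1 (hRE _ _ hab) ha

/-- If `x` is almost surely visited infinitely often, then time can be cut into windows such that
with probability close to one `x` is visited in every window. -/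
theorem exists_windows (μ : Measure (ℕ → S)) [IsFiniteMeasure μ] {x : S}
    (hx : ∀ᵐ π ∂μ, x ∈ infStates π) {ε : ℝ≥0∞} (hε : ε ≠ 0) :
    ∃ N : ℕ → ℕ, (∀ k, N k < N (k + 1)) ∧
      μ {π | ∃ k, ∀ i, N k ≤ i → i < N (k + 1) → π i ≠ x} < ε := by
  -- The windows are chosen one after the other, the `k`-th one so long that it misses `x` with
  -- probability less than `η k`, where `∑ η k < ε`.
  obtain ⟨η, hη, hsum⟩ := ENNReal.exists_pos_sum_of_countable hε ℕ
  have step : ∀ k n, ∃ n', n < n' ∧ μ {π : ℕ → S | ∀ i, n ≤ i → i < n' → π i ≠ x} < η k := by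
    intro k n
    set A : ℕ → Set (ℕ → S) := fun n' => {π | ∀ i, n ≤ i → i < n' → π i ≠ x} with hA
    have hmeas : ∀ n', MeasurableSet (A n') := by
      intro n'
      have : A n' = ⋂ i, ⋂ (_ : n ≤ i), ⋂ (_ : i < n'), {π : ℕ → S | π i = x}ᶜ := by
        ext π; simp [hA]
      rw [this]
      exact MeasurableSet.iInter fun i => MeasurableSet.iInter fun _ =>
        MeasurableSet.iInter fun _ => (measurableSet_apply_eq i x).compl
    have hanti : Antitone A := fun a b hab π hπ i h1 h2 => hπ i h1 (h2.trans_le hab)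
    have hlim := tendsto_measure_iInter_atTop (μ := μ) (fun n' => (hmeas n').nullMeasurableSet)
      hanti ⟨0, measure_ne_top _ _⟩
    have hzero : μ (⋂ n', A n') = 0 := by
      refine measure_mono_null (fun π hπ => ?_) (ae_iff.1 hx)
      intro hinf
      obtain ⟨j, hj, hjx⟩ := hinf n
      exact Set.mem_iInter.1 hπ (j + 1) j hj j.lt_succ_self hjx
    rw [hzero] at hlim
    have hpos : (0 : ℝ≥0∞) < η k := by exact_mod_cast hη k
    obtain ⟨n', h1, h2⟩ := ((hlim.eventually_lt_const hpos).and
      (Filter.eventually_gt_atTop n)).exists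
    exact ⟨n', h2, h1⟩
  choose f hf hfη using step
  refine ⟨fun k => Nat.rec 0 f k, fun k => hf k _, ?_⟩
  have hset : {π : ℕ → S | ∃ k, ∀ i, (Nat.rec 0 f k : ℕ) ≤ i →
      i < (Nat.rec 0 f (k + 1) : ℕ) → π i ≠ x} = ⋃ k, {π | ∀ i, (Nat.rec 0 f k : ℕ) ≤ i →
      i < (Nat.rec 0 f (k + 1) : ℕ) → π i ≠ x} := by
    ext π; simp only [Set.mem_iUnion]; rfl
  refine lt_of_le_of_lt ?_ hsum
  rw [hset]
  exact (measure_iUnion_le _).trans (ENNReal.tsum_le_tsum fun k => (hfη k _).le)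

end Probability

end MDP

/-! ### Sure and almost optimal strategies in very-good end-components -/

open MDP in
theorem lemma12 {S : Type*} [Fintype S] [MeasurableSpace S] [DiscreteMeasurableSpace S]
    (M : MDP S) (p₁ p₂ : S → ℕ) (C : Finset S) (hC : M.IsVGEC p₁ p₂ C)
    (s : S) (hs : s ∈ C) (ε : ℝ) (hε₀ : 0 < ε) (hε₁ : ε ≤ 1) :
    ∃ σ : M.Strategy, σ.Sure s (M.parity p₁) ∧ 1 - ε < (σ.prob s).real (M.parity p₂) := by
  classical
  obtain ⟨D, hDC, hD, ⟨m₁, ⟨⟨x, hx, hxm⟩, hm₁⟩, heven⟩, h₂⟩ := hC.exists_isClosedClass hs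
  have hR := exists_stays hC.isEC.trap hDC hD
  have hER := fun a b => stays_of_notMem (a := a) (b := b) hC.isEC.trap hD
  set U := M.memoryless (M.Stays C D) hR fun _ _ h => h.1 with hU
  have hinf : ∀ᵐ π ∂U.prob s, x ∈ infStates π := by
    filter_upwards [U.ae_of_nextDist_eq_memoryless s hR (fun _ _ h => h.1) hER] with π hπ
    obtain ⟨h0, h1, h2⟩ := hπ fun _ => rfl
    rw [infStates_eq_of_stays hC.isEC hDC hD (h0 ▸ hs) h1 h2]
    exact hx
  obtain ⟨N, hN, hμ⟩ := exists_windows (U.prob s) hinf (ENNReal.ofReal_pos.2 hε₀).ne'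
  have : Nonempty M.Strategy := ⟨U⟩
  choose! τ hτ using hC.sure
  -- The time `m` ends a window in which `x` has not been visited.
  set Bad : ∀ m, Hist S m → Prop := fun m ρ => ∃ k, N (k + 1) = m ∧
    ∀ i (hi : i < m), N k ≤ i → ρ ⟨i, Finset.mem_Iic.2 hi.le⟩ ≠ x with hBad
  have hB : ∀ π : ℕ → S, (∃ m, Bad m (initSeg π m)) ↔
      ∃ k, ∀ i, N k ≤ i → i < N (k + 1) → π i ≠ x := by
    intro π
    constructor
    · rintro ⟨_, k, rfl, hk⟩
      exact ⟨k, fun i h1 h2 => hk i h2 h1⟩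
    · rintro ⟨k, hk⟩
      exact ⟨_, k, rfl, fun i h1 h2 => hk i h2 h1⟩
  have hstep : ∀ (π : ℕ → S) (n : ℕ), M.IsPlay π →
      (π n ∈ M.S₁ → π (n + 1) ∈ (U.act n (initSeg π n)).supp) →
      M.Stays C D (π n) (π (n + 1)) := by
    intro π n hπ hn
    by_cases h1 : π n ∈ M.S₁
    · have := hn h1
      rw [hU, supp_memoryless] at this
      exact this
    · exact hER _ _ h1 (hπ n)
  refine ⟨U.switch τ Bad, fun π hπ => ?_, ?_⟩
  · have hplay := hπ.1
    rcases Strategy.mem_out_switch hπ with ⟨hgood, hcons⟩ | ⟨m, hm, hout⟩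
    · refine ⟨hplay, m₁, ?_, heven⟩
      have hxinf : x ∈ infStates π := by
        intro i
        by_contra hno
        push Not at hno
        have hNi : i ≤ N i := (strictMono_nat_of_lt_succ hN).le_apply
        exact not_exists.2 hgood ((hB π).2 ⟨i, fun j hj _ => hno j (hNi.trans hj)⟩)
      have hsub := infStates_subset_of_stays (fun n => hstep π n hplay (hcons n)) hx hxinf
      exact ⟨⟨x, hxinf, hxm⟩, fun y hy => hm₁ (Set.image_mono hsub hy)⟩
    · have hmC : π m ∈ (C : Set S) := mem_of_forall_stays
        (fun n hn => hstep π n hplay (hm n hn)) (by rw [hπ.2.1]; exact hs)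
      exact mem_parity_of_shift hplay m (hτ _ hmC hout)
  · set σ := U.switch τ Bad with hσ
    have hbad : σ.prob s {π | ∃ m, Bad m (initSeg π m)} < ENNReal.ofReal ε := by
      rw [hσ, Strategy.prob_switch_bad]
      simpa only [hB] using hμ
    have hle : σ.prob s (M.parity p₂)ᶜ ≤ σ.prob s {π | ∃ m, Bad m (initSeg π m)} := by
      refine measure_mono_ae ?_
      filter_upwards [σ.ae_of_nextDist_eq_memoryless s hR (fun _ _ h => h.1) hER] with π hπ hnot
      by_contra hgood
      obtain ⟨h0, h1, h2⟩ := hπ fun n =>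
        Strategy.switch_nextDist_of_forall_not fun m _ hb => hgood ⟨m, hb⟩
      refine hnot ⟨fun n => (h1 n).1, ?_⟩
      rwa [infStates_eq_of_stays hC.isEC hDC hD (h0 ▸ hs) h1 h2]
    have hlt : (σ.prob s).real (M.parity p₂)ᶜ < ε :=
      (ENNReal.lt_ofReal_iff_toReal_lt (measure_ne_top _ _)).1 (hle.trans_lt hbad)
    rw [probReal_compl_eq_one_sub (measurableSet_parity _)] at hlt
    linarith
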